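/- For $n\in\mathbb{N}$ let $t_n\in\{0,1\}$ be the parity of the sum of the binary digits of $n$ (the Prouhet--Thue--Morse sequence), and let $F(X)=\sum_{n\ge 0}t_nX^n\in\mathbb{F}_2[[X]]$. Since $t_0=0$ and $t_1=1$, the series $F$ has a unique compositional inverse $G(X)=\sum_{n\ge 0}c_nX^n\in\mathbb{F}_2[[X]]$, that is, $G(0)=0$ and $F(G(X))=G(F(X))=X$. Regard each coefficient $c_n\in\{0,1\}$ as a complex number and put $C(X)=\sum_{n\ge 0}c_nX^n\in\mathbb{C}[[X]]$. Then $$C(X)=X(X+1)+\frac{X^3(X^4-1)}{(X-1)(X^4+1)}\,C(X^4)$$ in $\mathbb{C}[[X]]$ (where $(X-1)(X^4+1)$ is invertible). Moreover, $C(X)$ is transcendental over the field $\mathbb{C}(X)$ of rational functions. -/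

import Mathlib

open PowerSeries
open scoped RatFunc

noncomputable section

namespace IPTM

/-- The Prouhet-Thue-Morse sequence on `{0, 1}`: the parity of the sum of the binary digits. -/
def ptm (n : ℕ) : ℕ := (Nat.digits 2 n).sum % 2

/-- The generating series of the Prouhet-Thue-Morse sequence over the field with two elements. -/
def F : PowerSeries (ZMod 2) := PowerSeries.mk fun n => (ptm n : ZMod 2)

theorem constantCoeff_F : F.constantCoeff = 0 := by
  simp [F, ptm]

theorem coeff_one_F : F.coeff 1 = 1 := by
  simp [F, ptm]

theorem isUnit_coeff_one_F : IsUnit (F.coeff 1) := by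
  rw [coeff_one_F]; exact isUnit_one

/-- The compositional inverse of `F`. -/
def G : PowerSeries (ZMod 2) := F.substInvOfIsUnit isUnit_coeff_one_F

theorem constantCoeff_G : G.constantCoeff = 0 :=
  F.constantCoeff_substInvOfIsUnit isUnit_coeff_one_F

/-- `F(G(X)) = X`. -/
theorem F_comp_G : F.subst G = X :=
  F.subst_substInvOfIsUnit_right constantCoeff_F isUnit_coeff_one_F

/-- `G(F(X)) = X`. -/
theorem G_comp_F : G.subst F = X :=
  F.subst_substInvOfIsUnit_left constantCoeff_F isUnit_coeff_one_F

/-- The inverse Prouhet-Thue-Morse sequence, as a sequence of natural numbers in `{0, 1}`: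
`c n` is the representative in `{0, 1}` of the `n`-th coefficient of `G`. -/
def c (n : ℕ) : ℕ := (G.coeff n).val

/-- The generating series of `c` with complex coefficients. -/
def C : PowerSeries ℂ := PowerSeries.mk fun n => (c n : ℂ)

end IPTM

end

/-!
Write `L = 1 + X + X G`. The digit recursion of the Thue–Morse sequence makes `F` a root of a
quadratic over `𝔽₂(X)`, which can be rewritten as `(1 + (1 + X) F) ^ 3 = 1 + F`; substituting `G`
gives `L ^ 3 = 1 + X`. The product `M = ∏ (1 + X ^ 4 ^ i)` satisfies `M = (1 + X) M(X ^ 4)`, which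
modulo 2 says `(1 + X) M ^ 3 = 1`, so that `(1 + X) M(X ^ 2)` is another cube root of `1 + X`.
Cube roots with constant coefficient 1 are unique, hence `L = (1 + X) M(X ^ 2)`. Over any ring,
`M` and `((1 + X) M(X ^ 2) - 1 - X) / X` have coefficients in `{0, 1}`, so the latter is the lift
of `G`, and its functional equation follows from that of `M`.

If `M` were algebraic over `k(X)`, comparing the constant coefficients of its minimal polynomial
and of the `X ↦ X ^ 4` twist of that polynomial would give a nonzero rational function `r` with
`r(X) = (1 + X) ^ m r(X ^ 4)` and `m > 0`. By degrees its numerator is constant, so its denominator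
`Q` satisfies `Q(X ^ 4) = (1 + X) ^ m Q(X)` and has degree `m / 3`. If `2 ≠ 0`, this is
incompatible with `(1 - X) ^ m ∣ Q`, which follows because `X ↦ -X` fixes the left side.
-/

namespace IPTM

open scoped Polynomial

section Transcendence

theorem exists_eq_pow_mul_map_of_isAlgebraic {K L : Type*} [Field K] [CommRing L] [IsDomain L]
    [Algebra K L] {σ : K →+* K} {τ : L →+* L}
    (hστ : (algebraMap K L).comp σ = τ.comp (algebraMap K L)) {a : K} {f : L} (hf₀ : f ≠ 0)
    (hf : f = algebraMap K L a * τ f) (halg : IsAlgebraic K f) :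
    ∃ m > 0, ∃ r : K, r ≠ 0 ∧ r = a ^ m * σ r := by
  have hint : IsIntegral K f := halg.isIntegral
  set p := minpoly K f with hp
  have hmonic : p.Monic := minpoly.monic hint
  -- The roots of `(p.map σ).scaleRoots a` are `a` times those of `p.map σ`, which kills `τ f`.
  have hroot : Polynomial.aeval f ((p.map σ).scaleRoots a) = 0 := by
    rw [hf]
    apply Polynomial.scaleRoots_aeval_eq_zero
    rw [← Polynomial.map_aeval_eq_aeval_map hστ, hp, minpoly.aeval, map_zero]
  have hfixed : (p.map σ).scaleRoots a = p :=
    Polynomial.eq_of_monic_of_dvd_of_natDegree_le hmonic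
      ((Polynomial.monic_scaleRoots_iff a).2 (hmonic.map σ)) (minpoly.dvd K f hroot)
      (by rw [Polynomial.natDegree_scaleRoots, Polynomial.natDegree_map])
  refine ⟨p.natDegree, minpoly.natDegree_pos hint, p.coeff 0,
    minpoly.coeff_zero_ne_zero hint hf₀, ?_⟩
  have hcoeff := congrArg (Polynomial.coeff · 0) hfixed
  simp only [Polynomial.coeff_scaleRoots, Polynomial.coeff_map, Polynomial.natDegree_map,
    tsub_zero] at hcoeff
  rw [mul_comm, hcoeff]

section FractionRing

variable {A B K L : Type*} [CommRing A] [CommRing B] [IsDomain B] [CommRing K]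
  [CommRing L] [Algebra A K] [IsFractionRing A K] [Algebra B L] [IsFractionRing B L]

theorem fractionRing_map_algebraMap {j : A →+* B} (hj : Function.Injective j) (x : A) :
    IsFractionRing.map hj (algebraMap A K x) = algebraMap B L (j x) :=
  IsLocalization.map_eq _ x

theorem algebraMap_comp_fractionRing_map [IsDomain A] [Algebra A B] [Algebra K L] [Algebra A L]
    [IsScalarTower A K L] [IsScalarTower A B L] {σ : A →+* A} (hσ : Function.Injective σ)
    {τ : B →+* B} (hτ : Function.Injective τ)
    (h : (algebraMap A B).comp σ = τ.comp (algebraMap A B)) :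
    (algebraMap K L).comp (IsFractionRing.map hσ) =
      (IsFractionRing.map hτ).comp (algebraMap K L) :=
  IsLocalization.ringHom_ext (nonZeroDivisors A) <| RingHom.ext fun x => calc
    algebraMap K L (IsFractionRing.map hσ (algebraMap A K x))
      = algebraMap B L (algebraMap A B (σ x)) := by
        rw [fractionRing_map_algebraMap, ← IsScalarTower.algebraMap_apply,
          ← IsScalarTower.algebraMap_apply]
    _ = IsFractionRing.map hτ (algebraMap B L (algebraMap A B x)) := by
        rw [fractionRing_map_algebraMap, ← RingHom.comp_apply _ σ, h, RingHom.comp_apply]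
    _ = IsFractionRing.map hτ (algebraMap K L (algebraMap A K x)) := by
        rw [← IsScalarTower.algebraMap_apply, ← IsScalarTower.algebraMap_apply]

end FractionRing

variable {k : Type*} [Field k]

theorem expand_eq_mul_of_isCoprime {b : ℕ} (hb : 1 < b) {a P Q : k[X]} (hP : P ≠ 0)
    (hPQ : IsCoprime P Q)
    (h : P * Polynomial.expand k b Q = a * Polynomial.expand k b P * Q) :
    Polynomial.expand k b Q = a * Q := by
  have hdvd : Polynomial.expand k b P ∣ P :=
    ((Polynomial.isCoprime_expand (by lia)).2 hPQ).dvd_of_dvd_mul_right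
      ⟨a * Q, by rw [h]; ring⟩
  have hdeg : P.natDegree * b ≤ P.natDegree :=
    Polynomial.natDegree_expand b P ▸ Polynomial.natDegree_le_of_dvd hdvd hP
  obtain ⟨c, rfl⟩ : ∃ c, P = Polynomial.C c :=
    ⟨_, Polynomial.eq_C_of_natDegree_eq_zero (by nlinarith)⟩
  rw [Polynomial.expand_C] at h
  exact mul_left_cancel₀ hP (by rw [h]; ring)

theorem powerSeries_expand_injective {R : Type*} [CommRing R] {b : ℕ} (hb : b ≠ 0) :
    Function.Injective (expand b hb : R⟦X⟧ →ₐ[R] R⟦X⟧) := fun f g h => by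
  ext n
  rw [← coeff_expand_mul b hb f, h, coeff_expand_mul]

theorem algebraMap_comp_expand {R : Type*} [CommRing R] {b : ℕ} (hb : b ≠ 0) :
    (algebraMap R[X] R⟦X⟧).comp (Polynomial.expand R b).toRingHom =
      (expand b hb : R⟦X⟧ →ₐ[R] R⟦X⟧).toRingHom.comp (algebraMap R[X] R⟦X⟧) := by
  ext <;> simp [algebraMap_apply', expand_C]

theorem isAlgebraic_expand {R : Type*} [CommRing R] {b : ℕ} (hb : b ≠ 0) {f : R⟦X⟧}
    (hf : IsAlgebraic R[X] f) : IsAlgebraic R[X] (expand b hb f) :=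
  hf.ringHom_of_comp_eq (Polynomial.expand R b).toRingHom (expand b hb).toRingHom
    (Polynomial.expand_injective hb.bot_lt) (algebraMap_comp_expand hb)

instance isScalarTower_laurentSeries : IsScalarTower k[X] k⟦X⟧ (LaurentSeries k) :=
  .of_algebraMap_eq fun _ => rfl

theorem isAlgebraic_laurentSeries_iff {f : k⟦X⟧} :
    IsAlgebraic (RatFunc k) (f : LaurentSeries k) ↔ IsAlgebraic k[X] f := by
  rw [← IsFractionRing.isAlgebraic_iff k[X]]
  exact isAlgebraic_algebraMap_iff HahnSeries.ofPowerSeries_injective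

theorem exists_ratFunc_eq_pow_mul_expand {b : ℕ} (hb : b ≠ 0) {a : k[X]} {f : k⟦X⟧}
    (hf₀ : f ≠ 0) (hf : f = a * expand b hb f) (halg : IsAlgebraic k[X] f) :
    ∃ m > 0, ∃ r : RatFunc k, r ≠ 0 ∧ r = algebraMap k[X] (RatFunc k) a ^ m *
      IsFractionRing.map (K := RatFunc k) (j := (Polynomial.expand k b).toRingHom)
        (Polynomial.expand_injective hb.bot_lt) r := by
  have hτ := powerSeries_expand_injective (R := k) hb
  refine exists_eq_pow_mul_map_of_isAlgebraic
    (algebraMap_comp_fractionRing_map _ hτ (algebraMap_comp_expand hb))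
    ((map_ne_zero_iff _ HahnSeries.ofPowerSeries_injective).2 hf₀) ?_
    (isAlgebraic_laurentSeries_iff.2 halg)
  refine (congrArg (algebraMap k⟦X⟧ (LaurentSeries k)) hf).trans ?_
  rw [map_mul]
  exact congrArg₂ _ (RatFunc.coe_coe a) (fractionRing_map_algebraMap hτ f).symm

theorem exists_expand_eq_pow_mul {b : ℕ} (hb : 1 < b) {a : k[X]} {f : k⟦X⟧} (hf₀ : f ≠ 0)
    (hf : f = a * expand b (by lia) f) (halg : IsAlgebraic k[X] f) :
    ∃ m > 0, ∃ Q : k[X], Q ≠ 0 ∧ Polynomial.expand k b Q = a ^ m * Q := by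
  obtain ⟨m, hm, r, hr₀, hr⟩ := exists_ratFunc_eq_pow_mul_expand (by lia) hf₀ hf halg
  refine ⟨m, hm, r.denom, r.denom_ne_zero,
    expand_eq_mul_of_isCoprime hb (RatFunc.num_ne_zero hr₀) r.isCoprime_num_denom ?_⟩
  have hdenom : algebraMap k[X] (RatFunc k) r.denom ≠ 0 :=
    RatFunc.algebraMap_ne_zero r.denom_ne_zero
  have hexpand : algebraMap k[X] (RatFunc k) (Polynomial.expand k b r.denom) ≠ 0 :=
    RatFunc.algebraMap_ne_zero ((Polynomial.expand_ne_zero (by lia)).2 r.denom_ne_zero)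
  apply RatFunc.algebraMap_injective k
  rw [← RatFunc.num_div_denom r, map_div₀, fractionRing_map_algebraMap,
    fractionRing_map_algebraMap] at hr
  simp only [AlgHom.toRingHom_eq_coe, RingHom.coe_coe] at hr
  field_simp at hr
  simp only [map_mul, map_pow]
  linear_combination hr

theorem isCoprime_one_sub_X_one_add_X (h2 : (2 : k) ≠ 0) :
    IsCoprime (1 - Polynomial.X : k[X]) (1 + Polynomial.X) := by
  have hinv : Polynomial.C (2⁻¹ : k) * 2 = 1 := by
    rw [← map_ofNat Polynomial.C 2, ← Polynomial.C_mul, inv_mul_cancel₀ h2, Polynomial.C_1]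
  exact ⟨Polynomial.C 2⁻¹, Polynomial.C 2⁻¹, by linear_combination hinv⟩

theorem not_expand_eq_one_add_X_pow_mul (h2 : (2 : k) ≠ 0) {b : ℕ} (hb : Even b) (hb2 : 2 < b)
    {m : ℕ} (hm : 0 < m) {Q : k[X]} (hQ : Q ≠ 0) :
    Polynomial.expand k b Q ≠ (1 + Polynomial.X) ^ m * Q := by
  intro h
  -- `Q(X ^ b)` is invariant under `X ↦ -X` because `b` is even.
  have heven : (1 - Polynomial.X) ^ m * Q.comp (-Polynomial.X) = (1 + Polynomial.X) ^ m * Q := by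
    have hneg := congrArg (Polynomial.comp · (-Polynomial.X)) h
    simp only [Polynomial.expand_eq_comp_X_pow, Polynomial.comp_assoc, Polynomial.pow_comp,
      Polynomial.X_comp, hb.neg_pow, Polynomial.mul_comp, Polynomial.add_comp,
      Polynomial.one_comp] at hneg
    rw [← h, Polynomial.expand_eq_comp_X_pow, hneg]
    ring
  have hdvd : (1 - Polynomial.X) ^ m ∣ Q :=
    (isCoprime_one_sub_X_one_add_X h2).pow.dvd_of_dvd_mul_left ⟨_, heven.symm⟩
  have hle : m ≤ Q.natDegree := by
    have hnat : (1 - Polynomial.X : k[X]).natDegree = 1 := by compute_degree!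
    simpa [Polynomial.natDegree_pow, hnat] using Polynomial.natDegree_le_of_dvd hdvd hQ
  have hdeg : Q.natDegree * b = m + Q.natDegree := by
    have hnat : (1 + Polynomial.X : k[X]).natDegree = 1 := by compute_degree!
    rw [← Polynomial.natDegree_expand, h, Polynomial.natDegree_mul _ hQ, Polynomial.natDegree_pow,
      hnat, mul_one]
    exact pow_ne_zero m (Polynomial.ne_zero_of_natDegree_gt (n := 0) (by lia))
  nlinarith

theorem transcendental_of_eq_one_add_X_mul_expand (h2 : (2 : k) ≠ 0) {b : ℕ} (hb : Even b)
    (hb2 : 2 < b) {f : k⟦X⟧} (hf₀ : f ≠ 0) (hf : f = (1 + X) * expand b (by lia) f) :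
    Transcendental k[X] f := fun halg => by
  obtain ⟨m, hm, Q, hQ, h⟩ := exists_expand_eq_pow_mul (a := 1 + Polynomial.X)
    (by lia : 1 < b) hf₀ (by simpa using hf) halg
  exact not_expand_eq_one_add_X_pow_mul h2 hb hb2 hm hQ h

end Transcendence

section MoserDeBruijn

theorem coeff_one_add_X_mul_expand {R : Type*} [CommRing R] {b : ℕ} (hb : 1 < b) (f : R⟦X⟧)
    (q : ℕ) {d : ℕ} (hd : d < b) :
    ((1 + X) * expand b (by lia) f).coeff (b * q + d) = if d ≤ 1 then f.coeff q else 0 := by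
  have hexpand (q d : ℕ) (hd₀ : 0 < d) (hd : d < b) :
      (expand b (by lia) f).coeff (b * q + d) = 0 :=
    coeff_expand_of_not_dvd _ _ _ <|
      (Nat.dvd_add_right (dvd_mul_right b q)).not.2 (Nat.not_dvd_of_pos_of_lt hd₀ hd)
  rw [add_mul, one_mul, map_add]
  match d with
  | 0 =>
    match q with
    | 0 => simp
    | q + 1 =>
      have hpred : b * (q + 1) = b * q + (b - 1) + 1 := by rw [mul_add_one]; lia
      rw [add_zero, coeff_expand_mul, hpred, coeff_succ_X_mul, hexpand q (b - 1) (by lia) (by lia)]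
      simp
  | 1 => simp [coeff_succ_X_mul, hexpand q 1 one_pos hb]
  | d + 2 =>
    rw [hexpand q (d + 2) (by lia) hd, ← add_assoc, coeff_succ_X_mul, add_assoc,
      hexpand q (d + 1) (by lia) (by lia)]
    simp

/-- The indicator function of the Moser–de Bruijn sequence, the set of sums of distinct powers
of `4`. -/
def moser (n : ℕ) : ℕ := if ∀ d ∈ Nat.digits 4 n, d ≤ 1 then 1 else 0

theorem moser_le_one (n : ℕ) : moser n ≤ 1 := by
  unfold moser; split_ifs <;> lia

theorem moser_zero : moser 0 = 1 := by simp [moser]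

theorem moser_four_mul_add (q : ℕ) {d : ℕ} (hd : d < 4) :
    moser (4 * q + d) = if d ≤ 1 then moser q else 0 := by
  rcases Nat.eq_zero_or_pos (4 * q + d) with h | h
  · obtain ⟨rfl, rfl⟩ : q = 0 ∧ d = 0 := by lia
    rfl
  · rw [moser, add_comm, Nat.digits_add 4 (by lia) d q hd (by lia)]
    by_cases hd1 : d ≤ 1 <;> simp [hd1, moser]

/-- The generating series `∏ (1 + X ^ 4 ^ i)` of the Moser–de Bruijn sequence. -/
noncomputable def moserSeries (R : Type*) [CommRing R] : R⟦X⟧ :=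
  PowerSeries.mk fun n => (moser n : R)

/-- The closed form of the inverse Prouhet-Thue-Morse sequence `c`, read off from the coefficients
of `1 + X + X * G = (1 + X) * M(X ^ 2)`, where `M` is the generating series of `moser`. -/
def inversePtm (n : ℕ) : ℕ := if n = 0 then 0 else moser ((n + 1) / 2)

theorem inversePtm_le_one (n : ℕ) : inversePtm n ≤ 1 := by
  unfold inversePtm
  split_ifs
  exacts [zero_le_one, moser_le_one _]

/-- The generating series of `inversePtm`, the lift of `G` to coefficients in `R`. -/
noncomputable def inversePtmSeries (R : Type*) [CommRing R] : R⟦X⟧ :=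
  PowerSeries.mk fun n => (inversePtm n : R)

variable (R : Type*) [CommRing R]

theorem constantCoeff_moserSeries : (moserSeries R).constantCoeff = 1 := by
  simp [moserSeries, moser_zero]

theorem moserSeries_eq :
    moserSeries R = (1 + X) * expand 4 four_ne_zero (moserSeries R) := by
  ext n
  rw [← Nat.div_add_mod n 4, coeff_one_add_X_mul_expand (by lia) _ _ (Nat.mod_lt n (by lia)),
    moserSeries, coeff_mk, moser_four_mul_add _ (Nat.mod_lt n (by lia))]
  simp

theorem one_add_X_add_X_mul_inversePtmSeries :
    1 + X + X * inversePtmSeries R = (1 + X) * expand 2 two_ne_zero (moserSeries R) := by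
  ext n
  have hlt : n % 2 < 2 := Nat.mod_lt n two_pos
  nth_rw 2 [← Nat.div_add_mod n 2]
  rw [coeff_one_add_X_mul_expand one_lt_two _ _ hlt, if_pos (by lia)]
  match n with
  | 0 => simp [moserSeries, moser_zero]
  | 1 => simp [moserSeries, moser_zero, inversePtmSeries, inversePtm]
  | n + 2 =>
    have hdiv : (n + 1 + 1) / 2 = n / 2 + 1 := by lia
    simp [moserSeries, inversePtmSeries, inversePtm, coeff_succ_X_mul, coeff_X, coeff_one, hdiv]

end MoserDeBruijn

section ModTwo

theorem eq_of_pow_eq_pow_of_constantCoeff_eq_one {R : Type*} [CommRing R] [IsDomain R] {n : ℕ}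
    (hn : (n : R) ≠ 0) {f g : R⟦X⟧} (hf : f.constantCoeff = 1) (hg : g.constantCoeff = 1)
    (h : f ^ n = g ^ n) : f = g := by
  have hprod := (Commute.all f g).geom_sum₂_mul n
  rw [h, sub_self] at hprod
  refine sub_eq_zero.1 ((mul_eq_zero.1 hprod).resolve_left fun hsum => hn ?_)
  simpa [hf, hg] using congrArg constantCoeff hsum

theorem expand_pow_eq_pow (p : ℕ) [Fact p.Prime] (n : ℕ) (hn : p ^ n ≠ 0) (f : (ZMod p)⟦X⟧) :
    expand (p ^ n) hn f = f ^ p ^ n := by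
  have hfrob : iterateFrobenius (ZMod p) p n = RingHom.id (ZMod p) := Subsingleton.elim _ _
  have h := MvPowerSeries.map_iterateFrobenius_expand p (NeZero.ne p) f n
  rw [hfrob, MvPowerSeries.map_id] at h
  exact h

instance charP_powerSeries {R : Type*} [CommRing R] (p : ℕ) [CharP R p] : CharP R⟦X⟧ p :=
  charP_of_injective_ringHom C_injective p

theorem ptm_two_mul_add (q : ℕ) {d : ℕ} (hd : d < 2) :
    (ptm (2 * q + d) : ZMod 2) = ptm q + d := by
  rcases Nat.eq_zero_or_pos (2 * q + d) with h | h
  · obtain ⟨rfl, rfl⟩ : q = 0 ∧ d = 0 := by lia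
    simp
  · simp [ptm, add_comm _ d, Nat.digits_add 2 one_lt_two d q hd (by lia), add_comm]

theorem F_add_expand_eq :
    F + expand 2 two_ne_zero (mk 1) = (1 + X) * expand 2 two_ne_zero (F + mk 1) := by
  ext n
  have hlt : n % 2 < 2 := Nat.mod_lt n two_pos
  rw [← Nat.div_add_mod n 2, coeff_one_add_X_mul_expand one_lt_two _ _ hlt, if_pos (by lia),
    map_add, map_add, coeff_expand, F, coeff_mk, coeff_mk, coeff_mk, ptm_two_mul_add _ hlt]
  rcases Nat.mod_two_eq_zero_or_one n with h | h
  · simp [h]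
  · have hdvd : ¬ 2 ∣ 2 * (n / 2) + 1 := by lia
    simp [h, hdvd]

theorem one_add_X_sq_mul_F : (1 + X) ^ 2 * F = (1 + X) ^ 3 * F ^ 2 + X := by
  have hF := F_add_expand_eq
  have hgeom : (mk 1 : (ZMod 2)⟦X⟧) * (1 - X) = 1 := mk_one_mul_one_sub_eq_one (ZMod 2)
  have hsq (f : (ZMod 2)⟦X⟧) : expand 2 two_ne_zero f = f ^ 2 := expand_pow_eq_pow 2 1 _ f
  rw [hsq, hsq] at hF
  rw [CharTwo.sub_eq_add] at hgeom
  linear_combination (1 + X) ^ 2 * hF + X * (mk 1 * (1 + X) + 1) * hgeom +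
    (1 + X) ^ 3 * F * mk 1 * CharTwo.two_eq_zero (R := (ZMod 2)⟦X⟧)

theorem one_add_mul_F_pow_three : (1 + (1 + X) * F) ^ 3 = 1 + F := by
  linear_combination -F * one_add_X_sq_mul_F +
    (F * (1 + X) + 2 * F ^ 2 * (1 + X) ^ 2) * CharTwo.two_eq_zero (R := (ZMod 2)⟦X⟧)

theorem one_add_X_add_X_mul_G_pow_three : (1 + X + X * G) ^ 3 = 1 + X := by
  have hG : HasSubst G := HasSubst.of_constantCoeff_zero' constantCoeff_G
  have h := congrArg (substAlgHom hG) one_add_mul_F_pow_three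
  simp only [map_add, map_mul, map_pow, map_one, substAlgHom_X, coe_substAlgHom, F_comp_G] at h
  linear_combination h

theorem one_add_X_mul_expand_moserSeries_pow_three :
    ((1 + X) * expand 2 two_ne_zero (moserSeries (ZMod 2))) ^ 3 = 1 + X := by
  have hM₀ : moserSeries (ZMod 2) ≠ 0 := fun h => by
    simpa [h] using constantCoeff_moserSeries (ZMod 2)
  have hM : (1 + X) * moserSeries (ZMod 2) ^ 3 = 1 := by
    apply mul_left_cancel₀ hM₀
    have hM4 := moserSeries_eq (ZMod 2)
    have hfrob : expand 4 four_ne_zero (moserSeries (ZMod 2)) = moserSeries (ZMod 2) ^ 4 :=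
      expand_pow_eq_pow 2 2 _ _
    rw [hfrob] at hM4
    linear_combination -hM4
  have hfrob : expand 2 two_ne_zero (moserSeries (ZMod 2)) = moserSeries (ZMod 2) ^ 2 :=
    expand_pow_eq_pow 2 1 _ _
  rw [hfrob]
  linear_combination (1 + X) * ((1 + X) * moserSeries (ZMod 2) ^ 3 + 1) * hM

theorem G_eq_inversePtmSeries : G = inversePtmSeries (ZMod 2) := by
  have hroot : 1 + X + X * G = 1 + X + X * inversePtmSeries (ZMod 2) := by
    refine eq_of_pow_eq_pow_of_constantCoeff_eq_one (n := 3) (by decide) (by simp) (by simp) ?_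
    rw [one_add_X_add_X_mul_G_pow_three, one_add_X_add_X_mul_inversePtmSeries,
      one_add_X_mul_expand_moserSeries_pow_three]
  exact mul_left_cancel₀ X_ne_zero (add_left_cancel hroot)

theorem c_eq_inversePtm (n : ℕ) : c n = inversePtm n := by
  rw [c, G_eq_inversePtmSeries, inversePtmSeries, coeff_mk, ZMod.val_natCast,
    Nat.mod_eq_of_lt (Nat.lt_succ_of_le (inversePtm_le_one n))]

end ModTwo

section InversePtmSeries

variable (k : Type*) [Field k]

theorem expand_two_moserSeries_eq :
    expand 2 two_ne_zero (moserSeries k) =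
      (1 + X ^ 2) * expand 4 four_ne_zero (expand 2 two_ne_zero (moserSeries k)) := by
  conv_lhs => rw [moserSeries_eq]
  rw [map_mul, map_add, map_one, expand_X, ← expand_mul, ← expand_mul]

theorem inversePtmSeries_eq :
    inversePtmSeries k = X * (X + 1) + X ^ 3 * (X ^ 4 - 1) * ((X - 1) * (X ^ 4 + 1))⁻¹ *
      (inversePtmSeries k).subst (X ^ 4 : k⟦X⟧) := by
  rw [← expand_apply (hp := four_ne_zero)]
  have hE := one_add_X_add_X_mul_inversePtmSeries k
  have hE4 := congrArg (expand 4 four_ne_zero) hE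
  simp only [map_mul, map_add, map_one, expand_X] at hE4
  have hunit : constantCoeff ((X - 1) * (X ^ 4 + 1) : k⟦X⟧) ≠ 0 := by simp
  have hinv := PowerSeries.mul_inv_cancel _ hunit
  have hne : X * ((X - 1) * (X ^ 4 + 1)) ≠ (0 : k⟦X⟧) :=
    mul_ne_zero X_ne_zero fun h => hunit (by rw [h, map_zero])
  apply mul_left_cancel₀ hne
  linear_combination (X - 1) * (X ^ 4 + 1) * hE +
    (X ^ 2 - 1) * (X ^ 4 + 1) * expand_two_moserSeries_eq k - (X ^ 4 - 1) * hE4 -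
    X ^ 4 * (X ^ 4 - 1) * expand 4 four_ne_zero (inversePtmSeries k) * hinv

variable {k}

theorem transcendental_moserSeries (h2 : (2 : k) ≠ 0) : Transcendental k[X] (moserSeries k) :=
  transcendental_of_eq_one_add_X_mul_expand h2 (by decide) (by decide)
    (fun h => by simpa [h] using constantCoeff_moserSeries k) (moserSeries_eq k)

theorem transcendental_inversePtmSeries (h2 : (2 : k) ≠ 0) :
    Transcendental k[X] (inversePtmSeries k) := by
  intro hE
  have hX : IsAlgebraic k[X] (X : k⟦X⟧) := by
    simpa [algebraMap_apply'] using isAlgebraic_algebraMap (A := k⟦X⟧) (Polynomial.X : k[X])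
  have h1X : IsAlgebraic k[X] (1 + X : k⟦X⟧) := isAlgebraic_one.add hX
  have hne : (1 + X : k⟦X⟧) ≠ 0 := fun h => by simpa using congrArg constantCoeff h
  have hM2 : IsAlgebraic k[X] (expand 2 two_ne_zero (moserSeries k)) :=
    h1X.of_mul (mem_nonZeroDivisors_of_ne_zero hne)
      (one_add_X_add_X_mul_inversePtmSeries k ▸ h1X.add (hX.mul hE))
  have hM4 : IsAlgebraic k[X] (expand 4 four_ne_zero (moserSeries k)) := by
    simpa [← expand_mul] using isAlgebraic_expand two_ne_zero hM2
  exact transcendental_moserSeries h2 (moserSeries_eq k ▸ h1X.mul hM4)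

end InversePtmSeries

end IPTM

theorem mainTheorem5_general (k : Type*) [Field k] :
    letI f : k⟦X⟧ := PowerSeries.mk fun n => (IPTM.c n : k)
    f = X * (X + 1) + X ^ 3 * (X ^ 4 - 1) * ((X - 1) * (X ^ 4 + 1))⁻¹ * f.subst (X ^ 4 : k⟦X⟧) ∧
      ((2 : k) ≠ 0 → Transcendental (RatFunc k) (f : LaurentSeries k)) := by
  have hf : PowerSeries.mk (fun n => (IPTM.c n : k)) = IPTM.inversePtmSeries k :=
    congrArg PowerSeries.mk (funext fun n => by rw [IPTM.c_eq_inversePtm])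
  rw [hf]
  exact ⟨IPTM.inversePtmSeries_eq k, fun h2 =>
    mt IPTM.isAlgebraic_laurentSeries_iff.1 (IPTM.transcendental_inversePtmSeries h2)⟩

theorem mainTheorem5 :
    IPTM.C = X * (X + 1)
        + X ^ 3 * (X ^ 4 - 1) * ((X - 1) * (X ^ 4 + 1))⁻¹ * IPTM.C.subst (X ^ 4 : PowerSeries ℂ) ∧
      Transcendental (RatFunc ℂ) (IPTM.C : LaurentSeries ℂ) :=
  have ⟨heq, htrans⟩ := mainTheorem5_general ℂ
  ⟨heq, htrans two_ne_zero⟩
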